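/- **Model.** Let $X, Y, Z$ be finite sets, where $Z$ has a distinguished element $0$, and let $f : X \times Y \to Z$. Alice holds $x \in X$ and Bob holds $y \in Y$. In an entanglement-assisted two-way qubit protocol, the initial state is $|x\rangle|y\rangle|\phi\rangle|0\rangle$. Here $|x\rangle$ is Alice's input register and $|y\rangle$ is Bob's input register; $|\phi\rangle$ is a unit vector of arbitrary finite dimension, independent of $x$ and $y$, in a register that is shared between the two players and also contains their ancillas; and $|0\rangle \in \mathbb{C}^{Z}$ is the initial state of an output register held by Bob. In a finite number of rounds, Alice and Bob apply unitaries to the registers and qubits that they currently hold, and between rounds they send some of their qubits to each other, following a schedule that does not depend on the inputs. There are no intermediate measurements. At the end the output register is measured in the computational basis, and the result is Bob's output. The cost is the total number of qubits sent, in both directions together. Let $\mathrm{Qcc}(f)$ be the minimum cost of such a protocol whose output equals $f(x,y)$ with probability at least $2/3$ for every $(x,y) \in X \times Y$. For a finite field $\mathbb{F}_q$ define $\mathsf{PS} : \mathbb{F}_q \times \mathbb{F}_q \to \{0,1\}$ by $\mathsf{PS}(x,y) = 1$ if $x + y = z^2$ for some $z \in \mathbb{F}_q$, and $\mathsf{PS}(x,y)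 = 0$ otherwise. **Theorem.** There is an absolute constant $c > 0$ such that for every $q$ that is a power (with positive exponent) of an odd prime, $$\mathrm{Qcc}(\mathsf{PS}) \ \ge\ c \log_2 q .$$ -/

import Mathlib

/-- `overwrite S m s` is the configuration of `k` bits that agrees with `s` on the positions in `S`
and with `m` elsewhere. -/
def overwrite {k : ℕ} (S : Finset (Fin k)) (m : Fin k → Bool) (s : S → Bool) : Fin k → Bool :=
  fun j => if h : j ∈ S then s ⟨j, h⟩ else m j

/-- Computational basis of Alice's part when she holds the transferable qubits in `S`:
her input register, her half of the shared register, and the qubits in `S`. -/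
abbrev AliceBasis (X : Type*) (dA k : ℕ) (S : Finset (Fin k)) : Type _ :=
  X × Fin dA × (S → Bool)

/-- Computational basis of Bob's part when he holds the transferable qubits in `S`:
his input register, his half of the shared register, the output register, and the qubits in `S`. -/
abbrev BobBasis (Y Z : Type*) (dB k : ℕ) (S : Finset (Fin k)) : Type _ :=
  Y × Fin dB × Z × (S → Bool)

/-- Computational basis of the whole system: Alice's input register, her half of the shared
register, Bob's input register, his half of the shared register, the output register,
the transferable qubits (which are a part of the shared register, too). -/
abbrev GlobalBasis (X Y Z : Type*) (dA dB k : ℕ) : Type _ :=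
  X × Fin dA × Y × Fin dB × Z × (Fin k → Bool)

/-- The action of `U ⊗ I` on a state, for a matrix `U` on Alice's part. -/
def aliceApply {X Y Z : Type*} [Fintype X] {dA dB k : ℕ} (S : Finset (Fin k))
    (U : Matrix (AliceBasis X dA k S) (AliceBasis X dA k S) ℂ)
    (ψ : GlobalBasis X Y Z dA dB k → ℂ) : GlobalBasis X Y Z dA dB k → ℂ :=
  fun (x, a, y, b, z, m) =>
    ∑ i : AliceBasis X dA k S,
      U (x, a, fun j => m j) i * ψ (i.1, i.2.1, y, b, z, overwrite S m i.2.2)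

/-- The action of `I ⊗ U` on a state, for a matrix `U` on Bob's part. -/
def bobApply {X Y Z : Type*} [Fintype Y] [Fintype Z] {dA dB k : ℕ} (S : Finset (Fin k))
    (U : Matrix (BobBasis Y Z dB k S) (BobBasis Y Z dB k S) ℂ)
    (ψ : GlobalBasis X Y Z dA dB k → ℂ) : GlobalBasis X Y Z dA dB k → ℂ :=
  fun (x, a, y, b, z, m) =>
    ∑ i : BobBasis Y Z dB k S,
      U (y, b, z, fun j => m j) i * ψ (x, a, i.1, i.2.1, i.2.2.1, overwrite S m i.2.2.2)

/-- A two-way qubit communication protocol with entanglement assistance. The players apply local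
unitaries in rounds `0, 1, …, rounds`; between consecutive rounds some qubits change hands.
There are no intermediate measurements. -/
structure QProtocol (X Y Z : Type*) [Fintype X] [DecidableEq X] [Fintype Y] [DecidableEq Y]
    [Fintype Z] [DecidableEq Z] where
  /-- dimension of the part of the shared register that always stays with Alice -/
  dA : ℕ
  /-- dimension of the part of the shared register that always stays with Bob -/
  dB : ℕ
  /-- number of transferable qubits -/
  k : ℕ
  /-- index of the last round -/
  rounds : ℕ
  /-- `held t` is the set of the transferable qubits that Alice holds in round `t`;
  Bob holds the other ones -/
  held : ℕ → Finset (Fin k)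
  /-- the initial state of the shared register (ancillas included), independent of the inputs -/
  shared : Fin dA × Fin dB × (Fin k → Bool) → ℂ
  shared_norm : ∑ i, ‖shared i‖ ^ 2 = 1
  /-- Alice's unitary in round `t` -/
  opA : ∀ t : ℕ, Matrix.unitaryGroup (AliceBasis X dA k (held t)) ℂ
  /-- Bob's unitary in round `t` -/
  opB : ∀ t : ℕ, Matrix.unitaryGroup (BobBasis Y Z dB k (held t)ᶜ) ℂ

namespace QProtocol

/-- The number of qubits exchanged, in both directions together: each transferable qubit is counted
each time that it changes hands. -/
def cost {X Y Z : Type*} [Fintype X] [DecidableEq X] [Fintype Y] [DecidableEq Y]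
    [Fintype Z] [DecidableEq Z] (P : QProtocol X Y Z) : ℕ :=
  ∑ t ∈ Finset.range P.rounds, (symmDiff (P.held t) (P.held (t + 1))).card

/-- The initial state `|x⟩|y⟩|φ⟩|0⟩`, with `φ` the shared state. -/
def initial {X Y Z : Type*} [Fintype X] [DecidableEq X] [Fintype Y] [DecidableEq Y]
    [Fintype Z] [DecidableEq Z] [Zero Z] (P : QProtocol X Y Z) (x : X) (y : Y) :
    GlobalBasis X Y Z P.dA P.dB P.k → ℂ :=
  fun (x', a, y', b, z, m) => if x' = x ∧ y' = y ∧ z = 0 then P.shared (a, b, m) else 0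

/-- The effect of round `t`: both players apply their local unitaries. -/
noncomputable def roundStep {X Y Z : Type*} [Fintype X] [DecidableEq X] [Fintype Y] [DecidableEq Y]
    [Fintype Z] [DecidableEq Z] (P : QProtocol X Y Z) (t : ℕ)
    (ψ : GlobalBasis X Y Z P.dA P.dB P.k → ℂ) : GlobalBasis X Y Z P.dA P.dB P.k → ℂ :=
  bobApply (P.held t)ᶜ (P.opB t).1 (aliceApply (P.held t) (P.opA t).1 ψ)

/-- The state after rounds `0, …, t` on inputs `x`, `y`. -/
noncomputable def state {X Y Z : Type*} [Fintype X] [DecidableEq X] [Fintype Y] [DecidableEq Y]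
    [Fintype Z] [DecidableEq Z] [Zero Z] (P : QProtocol X Y Z) (x : X) (y : Y) :
    ℕ → GlobalBasis X Y Z P.dA P.dB P.k → ℂ
  | 0 => P.roundStep 0 (P.initial x y)
  | t + 1 => P.roundStep (t + 1) (P.state x y t)

/-- The probability that Bob outputs `z` on inputs `x`, `y`, that is, that a measurement of the
output register at the end, in the computational basis, gives `z`. -/
noncomputable def outputProb {X Y Z : Type*} [Fintype X] [DecidableEq X] [Fintype Y] [DecidableEq Y]
    [Fintype Z] [DecidableEq Z] [Zero Z] (P : QProtocol X Y Z) (x : X) (y : Y) (z : Z) : ℝ :=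
  ∑ c : GlobalBasis X Y Z P.dA P.dB P.k,
    if c.2.2.2.2.1 = z then ‖P.state x y P.rounds c‖ ^ 2 else 0

/-- `P` computes `f` with failure probability at most `ε`, on all pairs of inputs. -/
def Computes {X Y Z : Type*} [Fintype X] [DecidableEq X] [Fintype Y] [DecidableEq Y]
    [Fintype Z] [DecidableEq Z] [Zero Z] (P : QProtocol X Y Z) (f : X → Y → Z) (ε : ℝ) : Prop :=
  ∀ x y, 1 - ε ≤ P.outputProb x y (f x y)

end QProtocol

/-- The communication complexity of `f` with failure probability at most `ε` over an
entanglement-assisted two-way qubit channel: the minimal number of qubits exchanged. -/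
noncomputable def QccErr {X Y Z : Type*} [Fintype X] [DecidableEq X] [Fintype Y] [DecidableEq Y]
    [Fintype Z] [DecidableEq Z] [Zero Z] (ε : ℝ) (f : X → Y → Z) : ℕ :=
  sInf {n : ℕ | ∃ P : QProtocol X Y Z, P.Computes f ε ∧ P.cost = n}

/-- Bounded-error complexity: failure probability at most `1/3`. -/
noncomputable def Qcc {X Y Z : Type*} [Fintype X] [DecidableEq X] [Fintype Y] [DecidableEq Y]
    [Fintype Z] [DecidableEq Z] [Zero Z] (f : X → Y → Z) : ℕ :=
  QccErr (1 / 3) f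

open Classical in
/-- `PS x y` is `1` if `x + y` is a perfect square in `F`, and `0` otherwise. -/
noncomputable def PS (F : Type*) [Field F] (x y : F) : Fin 2 :=
  if ∃ z : F, x + y = z ^ 2 then 1 else 0

/-! Let `χ` be the quadratic character. The matrix with entries `χ (x + y)` has operator norm at
most `√q`, so it correlates weakly with anything bilinear in data of `x` and data of `y`; acceptance
probabilities of cheap protocols are short sums of such terms.

View a global state as a matrix with rows indexed by Alice's part and columns by Bob's. Local
unitaries multiply it on the left or right, and moving `d` qubits splits it into `2 ^ d` terms, one
per value of the moved bits (`toMat_transfer`). Hence after cost `C` the state is a sum of `2 ^ C`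
terms `A x * Φ * C y` with contractions `A x`, `C y` and a fixed `Φ` of Frobenius norm 1
(`hasProductDecomposition_state`). The acceptance probability is a squared Frobenius norm, hence a
sum of `4 ^ C` traces of a product of an `x`-matrix and a `y`-matrix, each of Frobenius norm at most
1. Its correlation with `χ (x + y)` is therefore at most `4 ^ C * q ^ (3/2)`
(`abs_sum_quadraticChar_mul_outputProb_le`).

Correctness forces this correlation to be at least `q * (q - 1) / 6`
(`le_sum_quadraticChar_mul_outputProb`), whence `4 ^ C ≥ (q - 1) / (6 * √q)`. The additive constant
in the resulting bound on `C` is absorbed by `C ≥ 1`: without communication Bob's reduced state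
ignores `x`. -/

open scoped Matrix Matrix.Norms.L2Operator

/-! ### Spectral bound for the quadratic character of a sum. -/

section CharacterSums

variable {F : Type*} [Field F] [Fintype F] [DecidableEq F]

/-- For `a ≠ b` an affine substitution turns the sum into `χ (-1)` times the Jacobi sum of `χ` with
its inverse, which is `-χ (-1)`. -/
theorem quadraticChar_sum_mul_shift (hF : ringChar F ≠ 2) (a b : F) :
    ∑ y : F, quadraticChar F (a + y) * quadraticChar F (b + y)
      = (if a = b then (Fintype.card F : ℤ) else 0) - 1 := by
  by_cases hab : a = b
  · subst hab
    rw [if_pos rfl, Fintype.sum_equiv (Equiv.addLeft a)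
      (fun y => quadraticChar F (a + y) * quadraticChar F (a + y))
      (fun y => if y = 0 then 0 else 1)]
    · simp [Finset.sum_ite, Finset.filter_ne', Nat.cast_sub Fintype.card_pos]
    · intro y
      change _ = if a + y = 0 then (0 : ℤ) else 1
      split_ifs with h
      · simp [h]
      · rw [← sq, quadraticChar_sq_one h]
  · have hd : b - a ≠ 0 := sub_ne_zero.2 (Ne.symm hab)
    have hJ := jacobiSum_nontrivial_inv (quadraticChar_ne_one (F := F) hF)
    rw [(quadraticChar_isQuadratic F).inv, jacobiSum] at hJ
    have key : ∑ y : F, quadraticChar F (a + y) * quadraticChar F (b + y)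
        = ∑ w : F, quadraticChar F (-1) * (quadraticChar F w * quadraticChar F (1 - w)) := by
      symm
      refine Fintype.sum_equiv ((Equiv.mulLeft₀ (-(b - a)) (neg_ne_zero.2 hd)).trans
        (Equiv.subRight a)) _ _ fun w => ?_
      change _ = quadraticChar F (a + (-(b - a) * w - a)) * quadraticChar F (b + (-(b - a) * w - a))
      have h1 : a + (-(b - a) * w - a) = (-1) * (b - a) * w := by ring
      have h2 : b + (-(b - a) * w - a) = (b - a) * (1 - w) := by ring
      rw [h1, h2]
      simp only [map_mul]
      linear_combination (-(quadraticChar F (-1) * quadraticChar F w * quadraticChar F (1 - w))) *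
        quadraticChar_sq_one hd
    rw [key, ← Finset.mul_sum, hJ, if_neg hab]
    have := quadraticChar_sq_one (F := F) (a := -1) (by simp)
    linear_combination -this

/-- The Gram matrix of the shifts is `q` times the identity minus the all-ones matrix, so the two
sides differ exactly by `‖∑ x, u x‖ ^ 2`. -/
theorem sum_sq_norm_quadraticChar_shift_le (hF : ringChar F ≠ 2) (u : F → ℂ) :
    ∑ y : F, ‖∑ x : F, (quadraticChar F (x + y) : ℂ) * u x‖ ^ 2
      ≤ Fintype.card F * ∑ x : F, ‖u x‖ ^ 2 := by
  have key : ((∑ y : F, ‖∑ x : F, (quadraticChar F (x + y) : ℂ) * u x‖ ^ 2 : ℝ) : ℂ)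
      = ((Fintype.card F * ∑ x : F, ‖u x‖ ^ 2 - ‖∑ x : F, u x‖ ^ 2 : ℝ) : ℂ) := by
    push_cast
    simp only [← Complex.mul_conj', map_sum, map_mul, map_intCast, Finset.sum_mul_sum]
    rw [Finset.sum_comm, Finset.mul_sum, ← Finset.sum_sub_distrib]
    refine Finset.sum_congr rfl fun x _ => ?_
    rw [Finset.sum_comm]
    have h : ∀ x', ∑ y : F, (quadraticChar F (x + y) : ℂ) * u x *
        ((quadraticChar F (x' + y) : ℂ) * (starRingEnd ℂ) (u x'))
        = (if x = x' then (Fintype.card F : ℂ) * (u x * (starRingEnd ℂ) (u x')) else 0)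
          - u x * (starRingEnd ℂ) (u x') := by
      intro x'
      have h0 := congrArg (Int.cast : ℤ → ℂ) (quadraticChar_sum_mul_shift hF x x')
      push_cast at h0
      calc _ = (∑ y : F, (quadraticChar F (x + y) : ℂ) * (quadraticChar F (x' + y) : ℂ)) *
            (u x * (starRingEnd ℂ) (u x')) := by
              rw [Finset.sum_mul]; exact Finset.sum_congr rfl fun y _ => by ring
        _ = _ := by rw [h0]; split_ifs <;> ring
    simp only [h, Finset.sum_sub_distrib, Finset.sum_ite_eq, Finset.mem_univ, if_true]
  have := Complex.ofReal_injective key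
  rw [this]
  linarith [sq_nonneg ‖∑ x : F, u x‖]

/-- The arithmetic mean replaces the product of norms so that the bound can be added up over matrix
entries. -/
theorem norm_sum_quadraticChar_mul_le (hF : ringChar F ≠ 2) (u v : F → ℂ) :
    ‖∑ x : F, ∑ y : F, (quadraticChar F (x + y) : ℂ) * (u x * v y)‖
      ≤ √(Fintype.card F) * ((∑ x, ‖u x‖ ^ 2 + ∑ y, ‖v y‖ ^ 2) / 2) := by
  set s := √(Fintype.card F : ℝ) with hs
  have hspos : 0 < s := Real.sqrt_pos.2 (by exact_mod_cast Fintype.card_pos)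
  have hss : s * s = Fintype.card F := Real.mul_self_sqrt (by positivity)
  set w : F → ℂ := fun y => ∑ x : F, (quadraticChar F (x + y) : ℂ) * u x
  have hw : ∑ y, ‖w y‖ ^ 2 ≤ s * s * ∑ x, ‖u x‖ ^ 2 := by
    rw [hss]; exact sum_sq_norm_quadraticChar_shift_le hF u
  have h1 : ∑ x : F, ∑ y : F, (quadraticChar F (x + y) : ℂ) * (u x * v y)
      = ∑ y, w y * v y := by
    rw [Finset.sum_comm]
    refine Finset.sum_congr rfl fun y _ => ?_
    rw [Finset.sum_mul]
    exact Finset.sum_congr rfl fun x _ => by ring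
  have h2 : s * ‖∑ y, w y * v y‖ ≤ ∑ y, (‖w y‖ ^ 2 + s * s * ‖v y‖ ^ 2) / 2 := by
    refine (mul_le_mul_of_nonneg_left (norm_sum_le _ _) hspos.le).trans ?_
    rw [Finset.mul_sum]
    refine Finset.sum_le_sum fun y _ => ?_
    rw [norm_mul]
    nlinarith [sq_nonneg (‖w y‖ - s * ‖v y‖)]
  rw [← Finset.sum_div, Finset.sum_add_distrib, ← Finset.mul_sum] at h2
  rw [h1]
  refine le_of_mul_le_mul_left ?_ hspos
  linarith

end CharacterSums

/-! ### Frobenius norm, contractions and selection matrices. -/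

section Matrices

variable {l m n : Type*} [Fintype l] [Fintype m] [Fintype n]

/-- The square of the Frobenius norm. -/
noncomputable def frobSq (M : Matrix m n ℂ) : ℝ := ∑ i, ∑ j, ‖M i j‖ ^ 2

theorem frobSq_mul_le [DecidableEq m] (A : Matrix l m ℂ) (M : Matrix m n ℂ) (hA : ‖A‖ ≤ 1) :
    frobSq (A * M) ≤ frobSq M := by
  unfold frobSq
  rw [Finset.sum_comm, Finset.sum_comm (γ := m)]
  refine Finset.sum_le_sum fun j _ => ?_
  have h := Matrix.l2_opNorm_mulVec A (WithLp.toLp 2 fun i => M i j)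
  have h' := h.trans (mul_le_of_le_one_left (norm_nonneg _) hA)
  have h2 := pow_le_pow_left₀ (norm_nonneg _) h' 2
  rw [EuclideanSpace.norm_sq_eq, EuclideanSpace.norm_sq_eq] at h2
  exact h2

theorem frobSq_conjTranspose (M : Matrix m n ℂ) : frobSq Mᴴ = frobSq M := by
  unfold frobSq
  rw [Finset.sum_comm]
  simp

theorem frobSq_mul_le_left [DecidableEq m] [DecidableEq n] (M : Matrix l m ℂ) (A : Matrix m n ℂ) (hA : ‖A‖ ≤ 1) :
    frobSq (M * A) ≤ frobSq M := by
  rw [← frobSq_conjTranspose, ← frobSq_conjTranspose M, Matrix.conjTranspose_mul]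
  exact frobSq_mul_le _ _ (by rwa [Matrix.l2_opNorm_conjTranspose])

theorem trace_conjTranspose_mul_self (M : Matrix m n ℂ) : (Mᴴ * M).trace = (frobSq M : ℂ) := by
  unfold frobSq
  rw [Finset.sum_comm]
  simp [Matrix.trace, Matrix.mul_apply, Complex.conj_mul']

theorem l2_opNorm_mul_le_one [DecidableEq m] [DecidableEq n] {A : Matrix l m ℂ} {B : Matrix m n ℂ} (hA : ‖A‖ ≤ 1) (hB : ‖B‖ ≤ 1) :
    ‖A * B‖ ≤ 1 :=
  (Matrix.l2_opNorm_mul A B).trans (mul_le_one₀ hA (norm_nonneg _) hB)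

theorem l2_opNorm_le_one_of_conjTranspose_mul_self [DecidableEq n] {A : Matrix m n ℂ} {d : n → ℂ}
    (h : Aᴴ * A = Matrix.diagonal d) (hd : ∀ i, ‖d i‖ ≤ 1) : ‖A‖ ≤ 1 := by
  have h1 := Matrix.l2_opNorm_conjTranspose_mul_self A
  rw [h, Matrix.l2_opNorm_diagonal] at h1
  have h2 : ‖d‖ ≤ 1 := (pi_norm_le_iff_of_nonneg zero_le_one).2 hd
  nlinarith [norm_nonneg A]

theorem l2_opNorm_unitary_le_one [DecidableEq n] (U : Matrix.unitaryGroup n ℂ) : ‖U.1‖ ≤ 1 := by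
  refine l2_opNorm_le_one_of_conjTranspose_mul_self (d := fun _ => 1) ?_ (by simp)
  rw [← Matrix.star_eq_conjTranspose, Matrix.diagonal_one]
  exact Matrix.mem_unitaryGroup_iff'.1 U.2

theorem l2_opNorm_unitary_transpose_le_one [DecidableEq n] (U : Matrix.unitaryGroup n ℂ) :
    ‖U.1ᵀ‖ ≤ 1 := by
  refine l2_opNorm_le_one_of_conjTranspose_mul_self (d := fun _ => 1) ?_ (by simp)
  have h := Matrix.mem_unitaryGroup_iff.1 U.2
  rw [Matrix.star_eq_conjTranspose] at h
  rw [Matrix.diagonal_one, ← Matrix.transpose_one, ← h, Matrix.transpose_mul]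
  rfl

/-- The matrix of the map that selects the entry `σ i` in each valid row `i`. -/
noncomputable def selection (V : m → Prop) (σ : m → n) : Matrix m n ℂ :=
  open Classical in fun i j => if V i ∧ j = σ i then 1 else 0

/-- Injectivity on the valid rows makes these rows distinct unit vectors, so the matrix times its
adjoint is a diagonal projection. -/
theorem l2_opNorm_selection_le_one [DecidableEq m] [DecidableEq n] (V : m → Prop) (σ : m → n)
    (hσ : ∀ i j, V i → V j → σ i = σ j → i = j) : ‖selection V σ‖ ≤ 1 := by
  classical
  rw [← Matrix.l2_opNorm_conjTranspose]
  refine l2_opNorm_le_one_of_conjTranspose_mul_self (d := fun i => if V i then 1 else 0) ?_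
    (fun i => by split_ifs <;> simp)
  ext i j
  rw [Matrix.conjTranspose_conjTranspose, Matrix.mul_apply]
  simp only [selection, Matrix.conjTranspose_apply, Matrix.diagonal_apply]
  by_cases hi : V i
  · by_cases hj : V j
    · by_cases hij : i = j
      · subst hij; simp [hi]
      · have : ¬σ j = σ i := fun h => hij (hσ i j hi hj h.symm)
        simp [hi, hj, hij, this]
    · have : i ≠ j := fun h => hj (h ▸ hi)
      simp [hj, this]
  · simp [hi]

theorem l2_opNorm_selection_transpose_le_one [DecidableEq m] [DecidableEq n] (V : m → Prop)
    (σ : m → n) (hσ : ∀ i j, V i → V j → σ i = σ j → i = j) : ‖(selection V σ)ᵀ‖ ≤ 1 := by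
  have h : (selection V σ)ᵀ = (selection V σ)ᴴ := by
    ext i j
    simp only [selection, Matrix.transpose_apply, Matrix.conjTranspose_apply]
    split_ifs <;> simp
  rw [h, Matrix.l2_opNorm_conjTranspose]
  exact l2_opNorm_selection_le_one V σ hσ

end Matrices

theorem selection_mul_apply {l m n : Type*} [Fintype m] (V : l → Prop) (σ : l → m) (M : Matrix m n ℂ) (i : l) (j : n) :
    (selection V σ * M) i j = open Classical in if V i then M (σ i) j else 0 := by
  classical
  by_cases h : V i <;> simp [selection, Matrix.mul_apply, h]

theorem mul_selection_transpose_apply {l m n : Type*} [Fintype m] (V : n → Prop) (σ : n → m) (M : Matrix l m ℂ) (i : l)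
    (j : n) :
    (M * (selection V σ)ᵀ) i j = open Classical in if V j then M i (σ j) else 0 := by
  classical
  by_cases h : V j <;> simp [selection, Matrix.mul_apply, h]

/-! ### States as matrices across the cut between Alice and Bob, and transfer of qubits. -/

section Registers

variable {k : ℕ}

/-- The configuration with the bits `s` on `S` and the bits `t` off `S`. -/
def mergeBits (S : Finset (Fin k)) (s : S → Bool) (t : (Sᶜ : Finset (Fin k)) → Bool) :
    Fin k → Bool :=
  fun j => if h : j ∈ S then s ⟨j, h⟩ else t ⟨j, Finset.mem_compl.2 h⟩

theorem mergeBits_restrict (S : Finset (Fin k)) (m : Fin k → Bool) :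
    mergeBits S (fun j => m j) (fun j => m j) = m := by
  funext j; simp [mergeBits]

theorem mergeBits_left (S : Finset (Fin k)) (s : S → Bool) (t : (Sᶜ : Finset (Fin k)) → Bool) :
    (fun j : S => mergeBits S s t j) = s := by
  funext j; simp [mergeBits]

theorem mergeBits_right (S : Finset (Fin k)) (s : S → Bool) (t : (Sᶜ : Finset (Fin k)) → Bool) :
    (fun j : (Sᶜ : Finset (Fin k)) => mergeBits S s t j) = t := by
  funext j
  have := Finset.mem_compl.1 j.2
  simp [mergeBits, this]

theorem overwrite_mergeBits (S : Finset (Fin k)) (s s' : S → Bool)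
    (t : (Sᶜ : Finset (Fin k)) → Bool) :
    overwrite S (mergeBits S s t) s' = mergeBits S s' t := by
  funext j
  by_cases h : j ∈ S <;> simp [overwrite, mergeBits, h]

theorem overwrite_compl_mergeBits (S : Finset (Fin k)) (s : S → Bool)
    (t t' : (Sᶜ : Finset (Fin k)) → Bool) :
    overwrite Sᶜ (mergeBits S s t) t' = mergeBits S s t' := by
  funext j
  by_cases h : j ∈ S <;> simp [overwrite, mergeBits, h]

/-- The bits on `S` that a holder of the bits `s` on `T` reconstructs with the message `w`. -/
def relabel (S T : Finset (Fin k)) (w : Fin k → Bool) (s : T → Bool) : S → Bool :=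
  fun j => if h : j.1 ∈ T then s ⟨j, h⟩ else w j

/-- The bits `s` on `T` agree with `w` on the positions in `D`. -/
def Agrees (T D : Finset (Fin k)) (w : Fin k → Bool) (s : T → Bool) : Prop :=
  ∀ j (h : j ∈ T), j ∈ D → s ⟨j, h⟩ = w j

/-- Relabelling forgets only the bits on `T \ S`, and agreement with `w` on `D` fixes those. -/
theorem relabel_injOn {S T D : Finset (Fin k)} (hD : ∀ j, j ∈ T → j ∉ S → j ∈ D)
    {w : Fin k → Bool} {s s' : T → Bool} (hs : Agrees T D w s) (hs' : Agrees T D w s')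
    (h : relabel S T w s = relabel S T w s') : s = s' := by
  funext ⟨j, hj⟩
  by_cases hjS : j ∈ S
  · simpa [relabel, hj] using congrFun h ⟨j, hjS⟩
  · rw [hs j hj (hD j hj hjS), hs' j hj (hD j hj hjS)]

theorem mergeBits_relabel (S T : Finset (Fin k)) {w : Fin k → Bool} {s : T → Bool}
    {t : (Tᶜ : Finset (Fin k)) → Bool} (hs : Agrees T (symmDiff S T) w s)
    (ht : Agrees Tᶜ (symmDiff S T) w t) :
    mergeBits S (relabel S T w s) (relabel Sᶜ Tᶜ w t) = mergeBits T s t := by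
  funext j
  by_cases hS : j ∈ S <;> by_cases hT : j ∈ T
  · simp [mergeBits, relabel, hS, hT]
  · have := ht j (Finset.mem_compl.2 hT) (by simp [Finset.mem_symmDiff, hS, hT])
    simp [mergeBits, relabel, hS, hT, this]
  · have := hs j hT (by simp [Finset.mem_symmDiff, hS, hT])
    simp [mergeBits, relabel, hS, hT, this]
  · simp [mergeBits, relabel, hS, hT]

/-- Extension of a configuration of the bits in `D` by `false`. -/
def extendBits {D : Finset (Fin k)} (w : D → Bool) : Fin k → Bool :=
  fun j => if h : j ∈ D then w ⟨j, h⟩ else false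

/-- Exactly one message passes both players' local tests, so each matrix entry receives a single
term in `toMat_transfer`. -/
theorem agrees_both_iff (T D : Finset (Fin k)) (s : T → Bool) (t : (Tᶜ : Finset (Fin k)) → Bool)
    (w : D → Bool) :
    (Agrees T D (extendBits w) s ∧ Agrees Tᶜ D (extendBits w) t) ↔
      w = fun j : D => mergeBits T s t j := by
  constructor
  · rintro ⟨hs, ht⟩
    funext ⟨j, hj⟩
    by_cases hT : j ∈ T
    · have := hs j hT hj
      simp only [extendBits, hj, dif_pos] at this
      simp [mergeBits, hT, this]
    · have := ht j (Finset.mem_compl.2 hT) hj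
      simp only [extendBits, hj, dif_pos] at this
      simp [mergeBits, hT, this]
  · rintro rfl
    constructor
    · intro j h hj
      simp [extendBits, hj, mergeBits, h]
    · intro j h hj
      have := Finset.mem_compl.1 h
      simp [extendBits, hj, mergeBits, this]

variable {X Y Z : Type*} {dA dB : ℕ}

/-- The matrix of a global state, with rows indexed by Alice's part and columns by Bob's part. -/
def toMat (S : Finset (Fin k)) (ψ : GlobalBasis X Y Z dA dB k → ℂ) :
    Matrix (AliceBasis X dA k S) (BobBasis Y Z dB k Sᶜ) ℂ :=
  fun p q => ψ (p.1, p.2.1, q.1, q.2.1, q.2.2.1, mergeBits S p.2.2 q.2.2.2)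

theorem toMat_aliceApply [Fintype X] (S : Finset (Fin k))
    (U : Matrix (AliceBasis X dA k S) (AliceBasis X dA k S) ℂ)
    (ψ : GlobalBasis X Y Z dA dB k → ℂ) :
    toMat S (aliceApply S U ψ) = U * toMat S ψ := by
  ext ⟨x, a, s⟩ ⟨y, b, z, t⟩
  simp only [toMat, aliceApply, Matrix.mul_apply, mergeBits_left, overwrite_mergeBits]

theorem toMat_bobApply [Fintype Y] [Fintype Z] (S : Finset (Fin k))
    (V : Matrix (BobBasis Y Z dB k Sᶜ) (BobBasis Y Z dB k Sᶜ) ℂ)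
    (ψ : GlobalBasis X Y Z dA dB k → ℂ) :
    toMat S (bobApply Sᶜ V ψ) = toMat S ψ * Vᵀ := by
  ext ⟨x, a, s⟩ ⟨y, b, z, t⟩
  simp only [toMat, bobApply, Matrix.mul_apply, mergeBits_right, overwrite_compl_mergeBits,
    Matrix.transpose_apply]
  exact Finset.sum_congr rfl fun i _ => mul_comm _ _

/-- Splitting of the global computational basis into Alice's part and Bob's part. -/
def splitEquiv (S : Finset (Fin k)) :
    AliceBasis X dA k S × BobBasis Y Z dB k Sᶜ ≃ GlobalBasis X Y Z dA dB k where
  toFun r := (r.1.1, r.1.2.1, r.2.1, r.2.2.1, r.2.2.2.1, mergeBits S r.1.2.2 r.2.2.2.2)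
  invFun c := ((c.1, c.2.1, fun j => c.2.2.2.2.2 j),
    (c.2.2.1, c.2.2.2.1, c.2.2.2.2.1, fun j => c.2.2.2.2.2 j))
  left_inv r := by simp [mergeBits_left, mergeBits_right]
  right_inv c := by simp [mergeBits_restrict]

/-- The contribution of the message `w` to Alice's side of a transfer of qubits. -/
noncomputable def aliceTransfer (X : Type*) (dA : ℕ) (S T D : Finset (Fin k)) (w : Fin k → Bool) :
    Matrix (AliceBasis X dA k T) (AliceBasis X dA k S) ℂ :=
  selection (fun p => Agrees T D w p.2.2) (fun p => (p.1, p.2.1, relabel S T w p.2.2))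

/-- The contribution of the message `w` to Bob's side of a transfer of qubits. -/
noncomputable def bobTransfer (Y Z : Type*) (dB : ℕ) (S T D : Finset (Fin k))
    (w : Fin k → Bool) : Matrix (BobBasis Y Z dB k T) (BobBasis Y Z dB k S) ℂ :=
  selection (fun p => Agrees T D w p.2.2.2)
    (fun p => (p.1, p.2.1, p.2.2.1, relabel S T w p.2.2.2))

theorem l2_opNorm_aliceTransfer_le_one [Fintype X] [DecidableEq X] (S T : Finset (Fin k))
    (w : Fin k → Bool) : ‖aliceTransfer X dA S T (symmDiff S T) w‖ ≤ 1 := by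
  refine l2_opNorm_selection_le_one _ _ ?_
  rintro ⟨x, a, s⟩ ⟨x', a', s'⟩ hs hs' h
  simp only [Prod.mk.injEq] at h ⊢
  exact ⟨h.1, h.2.1, relabel_injOn
    (fun j h1 h2 => by simp [Finset.mem_symmDiff, h1, h2]) hs hs' h.2.2⟩

theorem l2_opNorm_bobTransfer_le_one [Fintype Y] [DecidableEq Y] [Fintype Z] [DecidableEq Z]
    (S T : Finset (Fin k)) (w : Fin k → Bool) :
    ‖(bobTransfer Y Z dB Sᶜ Tᶜ (symmDiff S T) w)ᵀ‖ ≤ 1 := by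
  refine l2_opNorm_selection_transpose_le_one _ _ ?_
  rintro ⟨y, b, z, s⟩ ⟨y', b', z', s'⟩ hs hs' h
  simp only [Prod.mk.injEq] at h ⊢
  refine ⟨h.1, h.2.1, h.2.2.1, relabel_injOn (fun j h1 h2 => ?_) hs hs' h.2.2.2⟩
  simp only [Finset.mem_compl, not_not] at h1 h2
  simp [Finset.mem_symmDiff, h1, h2]

/-- Once the bits that change hands are fixed to `w`, each player recovers the old index from the
new one alone; the sum over `w` has `2 ^ d` terms for `d` moved qubits. -/
theorem toMat_transfer [Fintype X] [DecidableEq X] [Fintype Y] [DecidableEq Y] [Fintype Z]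
    [DecidableEq Z] (S T : Finset (Fin k)) (ψ : GlobalBasis X Y Z dA dB k → ℂ) :
    toMat T ψ = ∑ w : ↥(symmDiff S T) → Bool,
      aliceTransfer X dA S T (symmDiff S T) (extendBits w) * toMat S ψ *
        (bobTransfer Y Z dB Sᶜ Tᶜ (symmDiff S T) (extendBits w))ᵀ := by
  classical
  ext ⟨x, a, s⟩ ⟨y, b, z, t⟩
  have hiff := agrees_both_iff T (symmDiff S T) s t
  rw [Matrix.sum_apply, Finset.sum_eq_single
    (fun j : ↥(symmDiff S T) => mergeBits T s t j)]
  · obtain ⟨hs, ht⟩ := (hiff _).2 rfl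
    rw [bobTransfer, mul_selection_transpose_apply, if_pos ht, aliceTransfer, selection_mul_apply,
      if_pos hs]
    simp only [toMat, mergeBits_relabel S T hs ht]
  · intro w _ hw
    rw [bobTransfer, mul_selection_transpose_apply, aliceTransfer, selection_mul_apply]
    by_cases ht : Agrees Tᶜ (symmDiff S T) (extendBits w) t
    · have hs : ¬Agrees T (symmDiff S T) (extendBits w) s := fun hs => hw ((hiff w).1 ⟨hs, ht⟩)
      rw [if_pos ht, if_neg hs]
    · rw [if_neg ht]
  · simp

end Registers

/-! ### Product decompositions and their correlation with the character. -/

/-- The family `Ψ` is a sum of `N` families of the form `A x * Φ * C y` with contractions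
`A x` and `C y`. -/
def HasProductDecomposition {X Y m m₀ n n₀ : Type*} [Fintype m] [Fintype n] [Fintype m₀]
    [Fintype n₀] [DecidableEq m₀] [DecidableEq n]
    (Φ : Matrix m₀ n₀ ℂ) (N : ℕ) (Ψ : X → Y → Matrix m n ℂ) : Prop :=
  ∃ (ι : Type) (_ : Fintype ι) (A : ι → X → Matrix m m₀ ℂ) (C : ι → Y → Matrix n₀ n ℂ),
    Fintype.card ι = N ∧ (∀ i x, ‖A i x‖ ≤ 1) ∧ (∀ i y, ‖C i y‖ ≤ 1) ∧
      ∀ x y, Ψ x y = ∑ i, A i x * Φ * C i y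

namespace HasProductDecomposition

variable {X Y m m₀ n n₀ m' n' : Type*} [Fintype m] [Fintype n] [Fintype m₀] [Fintype n₀]
  [DecidableEq m₀] [DecidableEq n] [DecidableEq m] [Fintype m'] [Fintype n'] [DecidableEq n']
  {Φ : Matrix m₀ n₀ ℂ} {N : ℕ} {Ψ : X → Y → Matrix m n ℂ}

theorem sum_mul_mul {κ : Type} [Fintype κ] (R : κ → Matrix m' m ℂ) (Q : κ → Matrix n n' ℂ)
    (hR : ∀ w, ‖R w‖ ≤ 1) (hQ : ∀ w, ‖Q w‖ ≤ 1) (h : HasProductDecomposition Φ N Ψ) :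
    HasProductDecomposition Φ (N * Fintype.card κ) (fun x y => ∑ w, R w * Ψ x y * Q w) := by
  obtain ⟨ι, _, A, C, hc, hA, hC, hΨ⟩ := h
  refine ⟨ι × κ, inferInstance, fun i x => R i.2 * A i.1 x, fun i y => C i.1 y * Q i.2,
    by simp [hc], fun i x => l2_opNorm_mul_le_one (hR _) (hA _ _),
    fun i y => l2_opNorm_mul_le_one (hC _ _) (hQ _), fun x y => ?_⟩
  rw [Fintype.sum_prod_type_right]
  refine Finset.sum_congr rfl fun w _ => ?_
  rw [hΨ, Matrix.mul_sum, Matrix.sum_mul]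
  refine Finset.sum_congr rfl fun i _ => ?_
  simp only [Matrix.mul_assoc]

theorem mul_mul (R : Matrix m' m ℂ) (Q : Matrix n n' ℂ) (hR : ‖R‖ ≤ 1) (hQ : ‖Q‖ ≤ 1)
    (h : HasProductDecomposition Φ N Ψ) :
    HasProductDecomposition Φ N (fun x y => R * Ψ x y * Q) := by
  simpa using h.sum_mul_mul (κ := Unit) (fun _ => R) (fun _ => Q) (fun _ => hR) (fun _ => hQ)

end HasProductDecomposition

/-- The trace is a sum of scalar products `u x i j * v y j i`, so the scalar bound applies
entrywise, with no loss depending on the dimension. -/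
theorem norm_sum_quadraticChar_mul_trace_le {F : Type*} [Field F] [Fintype F] [DecidableEq F]
    {m n : Type*} [Fintype m] [Fintype n]
    (hF : ringChar F ≠ 2) (u : F → Matrix n m ℂ) (v : F → Matrix m n ℂ)
    (hu : ∀ x, frobSq (u x) ≤ 1) (hv : ∀ y, frobSq (v y) ≤ 1) :
    ‖∑ x : F, ∑ y : F, (quadraticChar F (x + y) : ℂ) * (u x * v y).trace‖
      ≤ √(Fintype.card F) * Fintype.card F := by
  have h1 : ∑ x : F, ∑ y : F, (quadraticChar F (x + y) : ℂ) * (u x * v y).trace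
      = ∑ i, ∑ j, ∑ x : F, ∑ y : F, (quadraticChar F (x + y) : ℂ) * (u x i j * v y j i) := by
    simp only [Matrix.trace, Matrix.diag_apply, Matrix.mul_apply, Finset.mul_sum]
    rw [Finset.sum_congr rfl fun x _ => Finset.sum_comm, Finset.sum_comm]
    refine Finset.sum_congr rfl fun i _ => ?_
    rw [Finset.sum_congr rfl fun x _ => Finset.sum_comm, Finset.sum_comm]
  have hsu : ∑ i, ∑ j, ∑ x : F, ‖u x i j‖ ^ 2 ≤ Fintype.card F := by
    calc _ = ∑ x : F, frobSq (u x) := by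
          unfold frobSq
          rw [Finset.sum_congr rfl fun i _ => Finset.sum_comm, Finset.sum_comm]
      _ ≤ ∑ _x : F, (1 : ℝ) := Finset.sum_le_sum fun x _ => hu x
      _ = _ := by simp
  have hsv : ∑ i, ∑ j, ∑ y : F, ‖v y j i‖ ^ 2 ≤ Fintype.card F := by
    calc _ = ∑ y : F, frobSq (v y) := by
          unfold frobSq
          rw [Finset.sum_comm, Finset.sum_congr rfl fun i _ => Finset.sum_comm, Finset.sum_comm]
      _ ≤ ∑ _y : F, (1 : ℝ) := Finset.sum_le_sum fun y _ => hv y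
      _ = _ := by simp
  rw [h1]
  calc _ ≤ ∑ i, ∑ j, √(Fintype.card F) *
        ((∑ x, ‖u x i j‖ ^ 2 + ∑ y, ‖v y j i‖ ^ 2) / 2) :=
        (norm_sum_le _ _).trans <| Finset.sum_le_sum fun i _ =>
          (norm_sum_le _ _).trans <| Finset.sum_le_sum fun j _ =>
            norm_sum_quadraticChar_mul_le hF _ _
    _ = √(Fintype.card F) * ((∑ i, ∑ j, ∑ x : F, ‖u x i j‖ ^ 2
          + ∑ i, ∑ j, ∑ y : F, ‖v y j i‖ ^ 2) / 2) := by
        simp only [← Finset.mul_sum, ← Finset.sum_div, Finset.sum_add_distrib]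
    _ ≤ _ := by
        refine mul_le_mul_of_nonneg_left ?_ (Real.sqrt_nonneg _)
        linarith

theorem HasProductDecomposition.norm_sum_quadraticChar_mul_frobSq_le {F : Type*} [Field F]
    [Fintype F] [DecidableEq F] {m n m₀ n₀ : Type*} [Fintype m] [Fintype n] [Fintype m₀]
    [Fintype n₀] [DecidableEq m₀] [DecidableEq n₀] [DecidableEq n] [DecidableEq m]
    (hF : ringChar F ≠ 2) {Φ : Matrix m₀ n₀ ℂ} (hΦ : frobSq Φ ≤ 1) {N : ℕ}
    {Ψ : F → F → Matrix m n ℂ} (h : HasProductDecomposition Φ N Ψ) :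
    |∑ x : F, ∑ y : F, (quadraticChar F (x + y) : ℝ) * frobSq (Ψ x y)|
      ≤ N ^ 2 * (√(Fintype.card F) * Fintype.card F) := by
  obtain ⟨ι, _, A, C, hc, hA, hC, hΨ⟩ := h
  -- Expanding the square and using cyclicity of the trace separates a factor depending on `x` only
  -- from one depending on `y` only; `Φ` is shared out to both, so each has Frobenius norm at most
  -- 1.
  have h1 : ∀ x y, (frobSq (Ψ x y) : ℂ)
      = ∑ i, ∑ j, ((Φᴴ * ((A i x)ᴴ * A j x)) * (Φ * (C j y * (C i y)ᴴ))).trace := by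
    intro x y
    rw [← trace_conjTranspose_mul_self, hΨ, Matrix.conjTranspose_sum, Matrix.sum_mul,
      Matrix.trace_sum]
    refine Finset.sum_congr rfl fun i _ => ?_
    rw [Matrix.mul_sum, Matrix.trace_sum]
    refine Finset.sum_congr rfl fun j _ => ?_
    rw [Matrix.conjTranspose_mul, Matrix.mul_assoc, Matrix.trace_mul_comm]
    simp only [Matrix.conjTranspose_mul, Matrix.mul_assoc]
  have h2 : ((∑ x : F, ∑ y : F, (quadraticChar F (x + y) : ℝ) * frobSq (Ψ x y) : ℝ) : ℂ)
      = ∑ i, ∑ j, ∑ x : F, ∑ y : F, (quadraticChar F (x + y) : ℂ) *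
        ((Φᴴ * ((A i x)ᴴ * A j x)) * (Φ * (C j y * (C i y)ᴴ))).trace := by
    push_cast
    simp only [h1, Finset.mul_sum]
    rw [Finset.sum_congr rfl fun x _ => Finset.sum_comm, Finset.sum_comm]
    refine Finset.sum_congr rfl fun i _ => ?_
    rw [Finset.sum_congr rfl fun x _ => Finset.sum_comm, Finset.sum_comm]
  rw [← Real.norm_eq_abs, ← Complex.norm_real, h2]
  calc _ ≤ ∑ _i : ι, ∑ _j : ι, √(Fintype.card F) * (Fintype.card F : ℝ) := by
        refine (norm_sum_le _ _).trans <| Finset.sum_le_sum fun i _ =>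
          (norm_sum_le _ _).trans <| Finset.sum_le_sum fun j _ =>
            norm_sum_quadraticChar_mul_trace_le hF _ _ (fun x => ?_) (fun y => ?_)
        · refine (frobSq_mul_le_left _ _ (l2_opNorm_mul_le_one ?_ (hA _ _))).trans ?_
          · rw [Matrix.l2_opNorm_conjTranspose]; exact hA _ _
          · rwa [frobSq_conjTranspose]
        · refine (frobSq_mul_le_left _ _ (l2_opNorm_mul_le_one (hC _ _) ?_)).trans hΦ
          rw [Matrix.l2_opNorm_conjTranspose]; exact hC _ _
    _ = _ := by simp [hc]; ring

/-! ### Structure of the states of a protocol. -/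

namespace QProtocol

section General

variable {X Y Z : Type*} [Fintype X] [DecidableEq X] [Fintype Y] [DecidableEq Y]
  [Fintype Z] [DecidableEq Z] (P : QProtocol X Y Z)

theorem toMat_roundStep (t : ℕ) (ψ : GlobalBasis X Y Z P.dA P.dB P.k → ℂ) :
    toMat (P.held t) (P.roundStep t ψ)
      = (P.opA t).1 * toMat (P.held t) ψ * ((P.opB t).1)ᵀ := by
  rw [roundStep, toMat_bobApply, toMat_aliceApply]

/-- The matrix of the shared state, for Alice holding the qubits in `S`. -/
def sharedMat (S : Finset (Fin P.k)) :
    Matrix (Fin P.dA × (S → Bool)) (Fin P.dB × ((Sᶜ : Finset (Fin P.k)) → Bool)) ℂ :=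
  fun p q => P.shared (p.1, q.1, mergeBits S p.2 q.2)

theorem frobSq_sharedMat (S : Finset (Fin P.k)) : frobSq (P.sharedMat S) = 1 := by
  rw [← P.shared_norm, frobSq, ← Fintype.sum_prod_type']
  let e : (Fin P.dA × (S → Bool)) × (Fin P.dB × ((Sᶜ : Finset (Fin P.k)) → Bool)) ≃
      Fin P.dA × Fin P.dB × (Fin P.k → Bool) :=
    { toFun := fun r => (r.1.1, r.2.1, mergeBits S r.1.2 r.2.2)
      invFun := fun c => ((c.1, fun j => c.2.2 j), (c.2.1, fun j => c.2.2 j))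
      left_inv := fun r => by simp [mergeBits_left, mergeBits_right]
      right_inv := fun c => by simp [mergeBits_restrict] }
  exact Fintype.sum_equiv e _ _ fun r => rfl

/-- The isometry that prepares Alice's input register. -/
noncomputable def aliceInput (S : Finset (Fin P.k)) (x : X) :
    Matrix (AliceBasis X P.dA P.k S) (Fin P.dA × (S → Bool)) ℂ :=
  selection (fun p => p.1 = x) (fun p => p.2)

theorem conjTranspose_aliceInput_mul_self (S : Finset (Fin P.k)) (x : X) :
    (P.aliceInput S x)ᴴ * P.aliceInput S x = 1 := by
  classical
  ext r r'
  simp only [aliceInput, selection, Matrix.mul_apply, Matrix.conjTranspose_apply, Matrix.one_apply]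
  rw [Fintype.sum_prod_type, Finset.sum_eq_single x]
  · by_cases h : r = r'
    · subst h; simp
    · simp [h]
  · intro x' _ hx
    simp [hx]
  · simp

theorem l2_opNorm_aliceInput_le_one (S : Finset (Fin P.k)) (x : X) :
    ‖P.aliceInput S x‖ ≤ 1 :=
  l2_opNorm_le_one_of_conjTranspose_mul_self (d := fun _ => 1)
    (by rw [conjTranspose_aliceInput_mul_self, Matrix.diagonal_one]) (by simp)

/-- The projection to the output `z`. -/
def outputProj (S : Finset (Fin P.k)) (z : Z) :
    Matrix (BobBasis Y Z P.dB P.k S) (BobBasis Y Z P.dB P.k S) ℂ :=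
  Matrix.diagonal fun q => if q.2.2.1 = z then 1 else 0

theorem l2_opNorm_outputProj_le_one (S : Finset (Fin P.k)) (z : Z) :
    ‖P.outputProj S z‖ ≤ 1 := by
  rw [outputProj, Matrix.l2_opNorm_diagonal]
  exact (pi_norm_le_iff_of_nonneg zero_le_one).2 fun q => by split_ifs <;> simp

theorem frobSq_toMat (S : Finset (Fin P.k)) (ψ : GlobalBasis X Y Z P.dA P.dB P.k → ℂ) :
    frobSq (toMat S ψ) = ∑ c, ‖ψ c‖ ^ 2 := by
  rw [frobSq, ← Fintype.sum_prod_type']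
  exact Fintype.sum_equiv (splitEquiv S) _ _ fun r => rfl

theorem frobSq_toMat_roundStep_le (t : ℕ) (ψ : GlobalBasis X Y Z P.dA P.dB P.k → ℂ) :
    frobSq (toMat (P.held t) (P.roundStep t ψ)) ≤ frobSq (toMat (P.held t) ψ) := by
  rw [toMat_roundStep]
  exact (frobSq_mul_le_left _ _ (l2_opNorm_unitary_transpose_le_one _)).trans
    (frobSq_mul_le _ _ (l2_opNorm_unitary_le_one _))

variable [Zero Z]

/-- The transpose of the isometry that prepares Bob's input register and the output register. -/
noncomputable def bobInput (S : Finset (Fin P.k)) (y : Y) :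
    Matrix (Fin P.dB × (S → Bool)) (BobBasis Y Z P.dB P.k S) ℂ :=
  (selection (fun q : BobBasis Y Z P.dB P.k S => q.1 = y ∧ q.2.2.1 = 0)
    (fun q => (q.2.1, q.2.2.2)))ᵀ

theorem l2_opNorm_bobInput_le_one (S : Finset (Fin P.k)) (y : Y) : ‖P.bobInput S y‖ ≤ 1 := by
  refine l2_opNorm_selection_transpose_le_one _ _ ?_
  rintro ⟨y, b, z, t⟩ ⟨y', b', z', t'⟩ ⟨rfl, rfl⟩ ⟨rfl, rfl⟩ h
  simp only [Prod.mk.injEq] at h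
  simp [h.1, h.2]

theorem toMat_initial (S : Finset (Fin P.k)) (x : X) (y : Y) :
    toMat S (P.initial x y)
      = P.aliceInput S x * P.sharedMat S * P.bobInput Sᶜ y := by
  ext ⟨x', a, s⟩ ⟨y', b, z, t⟩
  rw [bobInput, mul_selection_transpose_apply, aliceInput, selection_mul_apply]
  simp only [toMat, initial, sharedMat]
  split_ifs <;> tauto

theorem hasProductDecomposition_initial (S : Finset (Fin P.k)) :
    HasProductDecomposition (P.sharedMat S) 1 (fun x y => toMat S (P.initial x y)) :=
  ⟨Unit, inferInstance, fun _ => P.aliceInput S, fun _ => P.bobInput Sᶜ,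
    by simp, fun _ => P.l2_opNorm_aliceInput_le_one S, fun _ => P.l2_opNorm_bobInput_le_one Sᶜ,
    fun x y => by simp [toMat_initial]⟩

theorem hasProductDecomposition_state (t : ℕ) :
    HasProductDecomposition (P.sharedMat (P.held 0))
      (2 ^ ∑ r ∈ Finset.range t, (symmDiff (P.held r) (P.held (r + 1))).card)
      (fun x y => toMat (P.held t) (P.state x y t)) := by
  induction t with
  | zero =>
    simp only [state, toMat_roundStep]
    exact (P.hasProductDecomposition_initial (P.held 0)).mul_mul _ _
      (l2_opNorm_unitary_le_one _) (l2_opNorm_unitary_transpose_le_one _)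
  | succ t ih =>
    have h := ih.sum_mul_mul _ _
      (fun w : ↥(symmDiff (P.held t) (P.held (t + 1))) → Bool =>
        l2_opNorm_aliceTransfer_le_one (X := X) (dA := P.dA) (P.held t) (P.held (t + 1))
          (extendBits w))
      (fun w => l2_opNorm_bobTransfer_le_one (Y := Y) (Z := Z) (dB := P.dB) (P.held t)
        (P.held (t + 1)) (extendBits w))
    simp only [← toMat_transfer] at h
    -- The number of messages is 2 to the number of qubits moved, so the exponents add up to the
    -- cost.
    rw [Fintype.card_fun, Fintype.card_bool, Fintype.card_coe, ← pow_add,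
      ← Finset.sum_range_succ] at h
    simp only [state, toMat_roundStep]
    exact h.mul_mul _ _ (l2_opNorm_unitary_le_one _) (l2_opNorm_unitary_transpose_le_one _)

theorem outputProb_eq_sum (S : Finset (Fin P.k)) (x : X) (y : Y) (z : Z) :
    P.outputProb x y z
      = ∑ p, ∑ q, if q.2.2.1 = z then ‖toMat S (P.state x y P.rounds) p q‖ ^ 2 else 0 := by
  rw [outputProb, ← Fintype.sum_prod_type']
  exact (Fintype.sum_equiv (splitEquiv S) _ _ fun r => rfl).symm

theorem outputProb_eq_frobSq (S : Finset (Fin P.k)) (x : X) (y : Y) (z : Z) :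
    P.outputProb x y z
      = frobSq (toMat S (P.state x y P.rounds) * P.outputProj Sᶜ z) := by
  rw [P.outputProb_eq_sum S]
  refine Finset.sum_congr rfl fun p _ => Finset.sum_congr rfl fun q _ => ?_
  rw [outputProj, Matrix.mul_diagonal]
  split_ifs <;> simp

theorem frobSq_toMat_state_le_one (x : X) (y : Y) (t : ℕ) :
    frobSq (toMat (P.held t) (P.state x y t)) ≤ 1 := by
  induction t with
  | zero =>
    refine (P.frobSq_toMat_roundStep_le 0 _).trans ?_
    rw [toMat_initial, ← P.frobSq_sharedMat (P.held 0)]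
    exact (frobSq_mul_le_left _ _ (P.l2_opNorm_bobInput_le_one _ y)).trans
      (frobSq_mul_le _ _ (P.l2_opNorm_aliceInput_le_one _ x))
  | succ t ih =>
    refine (P.frobSq_toMat_roundStep_le (t + 1) _).trans ?_
    -- The Frobenius norm of a state does not depend on the cut, so handing over qubits leaves it
    -- unchanged.
    rwa [frobSq_toMat, ← P.frobSq_toMat (P.held t)]

theorem sum_outputProb_le_one (x : X) (y : Y) : ∑ z, P.outputProb x y z ≤ 1 := by
  refine le_of_eq_of_le ?_ (P.frobSq_toMat_state_le_one x y P.rounds)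
  simp only [P.outputProb_eq_sum (P.held P.rounds)]
  rw [Finset.sum_comm]
  refine Finset.sum_congr rfl fun p _ => ?_
  rw [Finset.sum_comm]
  exact Finset.sum_congr rfl fun q _ => by simp

/-- Without communication, Bob's reduced state does not depend on Alice's input. -/
theorem conjTranspose_toMat_mul_toMat_state (x x' : X) (y : Y)
    (t : ℕ) (h : ∀ r < t, P.held r = P.held (r + 1)) :
    (toMat (P.held t) (P.state x y t))ᴴ * toMat (P.held t) (P.state x y t)
      = (toMat (P.held t) (P.state x' y t))ᴴ * toMat (P.held t) (P.state x' y t) := by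
  have hround : ∀ t (ψ ψ' : GlobalBasis X Y Z P.dA P.dB P.k → ℂ),
      (toMat (P.held t) ψ)ᴴ * toMat (P.held t) ψ = (toMat (P.held t) ψ')ᴴ * toMat (P.held t) ψ' →
      (toMat (P.held t) (P.roundStep t ψ))ᴴ * toMat (P.held t) (P.roundStep t ψ)
        = (toMat (P.held t) (P.roundStep t ψ'))ᴴ * toMat (P.held t) (P.roundStep t ψ') := by
    intro t ψ ψ' h
    -- Alice's unitary cancels in the Gram matrix of the columns, which is Bob's reduced state up to
    -- transposition.
    have hU : ((P.opA t).1)ᴴ * (P.opA t).1 = 1 := Matrix.mem_unitaryGroup_iff'.1 (P.opA t).2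
    have key : ∀ ψ : GlobalBasis X Y Z P.dA P.dB P.k → ℂ,
        (toMat (P.held t) (P.roundStep t ψ))ᴴ * toMat (P.held t) (P.roundStep t ψ)
        = ((P.opB t).1ᵀ)ᴴ * ((toMat (P.held t) ψ)ᴴ * toMat (P.held t) ψ) * (P.opB t).1ᵀ := by
      intro ψ
      rw [toMat_roundStep]
      calc _ = ((P.opB t).1ᵀ)ᴴ * ((toMat (P.held t) ψ)ᴴ * (((P.opA t).1)ᴴ * (P.opA t).1) *
            toMat (P.held t) ψ) * (P.opB t).1ᵀ := by
              simp only [Matrix.conjTranspose_mul, Matrix.mul_assoc]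
        _ = _ := by rw [hU, Matrix.mul_one]
    rw [key, key, h]
  induction t with
  | zero =>
    refine hround _ _ _ ?_
    have key : ∀ x, (toMat (P.held 0) (P.initial x y))ᴴ * toMat (P.held 0) (P.initial x y)
        = (P.bobInput (P.held 0)ᶜ y)ᴴ * ((P.sharedMat (P.held 0))ᴴ *
          ((P.aliceInput (P.held 0) x)ᴴ * P.aliceInput (P.held 0) x) *
            P.sharedMat (P.held 0)) * P.bobInput (P.held 0)ᶜ y := by
      intro x
      rw [toMat_initial]
      simp only [Matrix.conjTranspose_mul, Matrix.mul_assoc]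
    rw [key, key, conjTranspose_aliceInput_mul_self, conjTranspose_aliceInput_mul_self]
  | succ t ih =>
    refine hround _ _ _ ?_
    rw [← h t (Nat.lt_succ_self t)]
    exact ih fun r hr => h r (hr.trans (Nat.lt_succ_self t))

theorem outputProb_eq_of_cost_eq_zero (h : P.cost = 0) (x x' : X) (y : Y) (z : Z) :
    P.outputProb x y z = P.outputProb x' y z := by
  have hheld : ∀ r < P.rounds, P.held r = P.held (r + 1) := by
    intro r hr
    have := (Finset.sum_eq_zero_iff.1 h) r (Finset.mem_range.2 hr)
    exact symmDiff_eq_bot.1 (Finset.card_eq_zero.1 this)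
  have hρ := P.conjTranspose_toMat_mul_toMat_state x x' y P.rounds hheld
  apply Complex.ofReal_injective
  rw [P.outputProb_eq_frobSq (P.held P.rounds), P.outputProb_eq_frobSq (P.held P.rounds),
    ← trace_conjTranspose_mul_self, ← trace_conjTranspose_mul_self]
  simp only [Matrix.conjTranspose_mul, Matrix.mul_assoc]
  simp only [← Matrix.mul_assoc _ _ (P.outputProj _ z), hρ]

/-- The output projection is a contraction on Bob's side, so it can be absorbed into the product
decomposition. -/
theorem abs_sum_quadraticChar_mul_outputProb_le {F : Type*} [Field F] [Fintype F]
    [DecidableEq F] (hF : ringChar F ≠ 2) (P : QProtocol F F Z) (z : Z) :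
    |∑ x : F, ∑ y : F, (quadraticChar F (x + y) : ℝ) * P.outputProb x y z|
      ≤ ((2 : ℝ) ^ P.cost) ^ 2 * (√(Fintype.card F) * Fintype.card F) := by
  have h := (P.hasProductDecomposition_state P.rounds).mul_mul 1
    (P.outputProj (P.held P.rounds)ᶜ z) (l2_opNorm_unitary_le_one 1)
    (P.l2_opNorm_outputProj_le_one _ z)
  simp only [Matrix.one_mul] at h
  have h' := h.norm_sum_quadraticChar_mul_frobSq_le hF (P.frobSq_sharedMat _).le
  simp only [← P.outputProb_eq_frobSq] at h'
  push_cast at h'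
  exact h'

end General

end QProtocol

/-! ### A trivial protocol, so that the minimum defining the complexity is attained. -/

theorem involutive_matrix_mem_unitaryGroup {m : Type*} [Fintype m] [DecidableEq m]
    {σ : m → m} (hσ : Function.Involutive σ) :
    (Matrix.of fun i j => if j = σ i then (1 : ℂ) else 0) ∈ Matrix.unitaryGroup m ℂ := by
  rw [Matrix.mem_unitaryGroup_iff]
  ext i j
  have : σ i = σ j ↔ i = j := hσ.injective.eq_iff
  simp [Matrix.mul_apply, Matrix.star_eq_conjTranspose, Matrix.one_apply, apply_ite, this, eq_comm]

theorem aliceApply_map {X Y Z : Type*} [Fintype X] [DecidableEq X] {dA dB k : ℕ}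
    (S : Finset (Fin k)) (σ : AliceBasis X dA k S → AliceBasis X dA k S)
    (ψ : GlobalBasis X Y Z dA dB k → ℂ) (x a y b z m) :
    aliceApply S (Matrix.of fun i j => if j = σ i then (1 : ℂ) else 0) ψ (x, a, y, b, z, m)
      = ψ ((σ (x, a, fun j => m j)).1, (σ (x, a, fun j => m j)).2.1, y, b, z,
          overwrite S m (σ (x, a, fun j => m j)).2.2) := by
  simp [aliceApply]

theorem bobApply_map {X Y Z : Type*} [Fintype Y] [DecidableEq Y] [Fintype Z] [DecidableEq Z]
    {dA dB k : ℕ} (S : Finset (Fin k)) (σ : BobBasis Y Z dB k S → BobBasis Y Z dB k S)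
    (ψ : GlobalBasis X Y Z dA dB k → ℂ) (x a y b z m) :
    bobApply S (Matrix.of fun i j => if j = σ i then (1 : ℂ) else 0) ψ (x, a, y, b, z, m)
      = ψ (x, a, (σ (y, b, z, fun j => m j)).1, (σ (y, b, z, fun j => m j)).2.1,
          (σ (y, b, z, fun j => m j)).2.2.1, overwrite S m (σ (y, b, z, fun j => m j)).2.2.2) := by
  simp [bobApply]

theorem overwrite_self {k : ℕ} (S : Finset (Fin k)) (m : Fin k → Bool) :
    overwrite S m (fun j => m j) = m := by
  funext j; simp [overwrite]

theorem extendBits_of_forall_mem {k : ℕ} {D : Finset (Fin k)} (m : Fin k → Bool)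
    (h : ∀ j, j ∈ D) : extendBits (fun j : D => m j) = m := by
  funext j; simp [extendBits, h]

theorem extendBits_of_forall_notMem {k : ℕ} {D : Finset (Fin k)} (m : Fin k → Bool)
    (h : ∀ j, j ∉ D) : extendBits (fun j : D => m j) = fun _ => false := by
  funext j; simp [extendBits, h]

namespace QProtocol

section SendInput

variable {X Y Z : Type*} [Fintype X] [AddCommGroup Z]

/-- The one-hot encoding of an element of a finite type. -/
noncomputable def oneHot (x : X) (j : Fin (Fintype.card X)) : Bool :=
  decide (j = Fintype.equivFin X x)

theorem oneHot_injective : Function.Injective (oneHot : X → Fin (Fintype.card X) → Bool) := by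
  intro x x' h
  have := congrFun h (Fintype.equivFin X x)
  simpa [oneHot] using this

/-- The value of `f` on the encoded first argument, or `0` for an invalid encoding. -/
noncomputable def decodeApply (f : X → Y → Z) (y : Y) (m : Fin (Fintype.card X) → Bool) : Z :=
  open Classical in if h : ∃ x : X, oneHot x = m then f h.choose y else 0

theorem decodeApply_oneHot (f : X → Y → Z) (x : X) (y : Y) :
    decodeApply f y (oneHot x) = f x y := by
  have h : ∃ x' : X, oneHot x' = oneHot x := ⟨x, rfl⟩
  rw [decodeApply, dif_pos h, oneHot_injective h.choose_spec]

/-- The zero string is not a one-hot code. Hence Bob can use the same operation in round 0, when he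
holds no qubits, without disturbing the output register. -/
theorem decodeApply_false (f : X → Y → Z) (y : Y) : decodeApply f y (fun _ => false) = 0 := by
  refine dif_neg ?_
  rintro ⟨x, hx⟩
  have := congrFun hx (Fintype.equivFin X x)
  simp [oneHot] at this

/-- Alice adds the encoding of her input to the qubits that she holds. -/
noncomputable def encodeMap (S : Finset (Fin (Fintype.card X)))
    (p : AliceBasis X 1 (Fintype.card X) S) : AliceBasis X 1 (Fintype.card X) S :=
  (p.1, p.2.1, fun j => xor (p.2.2 j) (oneHot p.1 j))

theorem encodeMap_involutive (S : Finset (Fin (Fintype.card X))) :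
    Function.Involutive (encodeMap S) := by
  rintro ⟨x, a, s⟩
  simp [encodeMap]

/-- Bob subtracts the output register from the value of `f` at the input encoded in the qubits
that he holds. -/
noncomputable def decodeMap (f : X → Y → Z) (S : Finset (Fin (Fintype.card X)))
    (q : BobBasis Y Z 1 (Fintype.card X) S) : BobBasis Y Z 1 (Fintype.card X) S :=
  (q.1, q.2.1, decodeApply f q.1 (extendBits q.2.2.2) - q.2.2.1, q.2.2.2)

/-- Subtracting the register from the value, rather than adding the value to it, gives an involution
in any abelian group and still sends `0` to the value. -/
theorem decodeMap_involutive (f : X → Y → Z) (S : Finset (Fin (Fintype.card X))) :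
    Function.Involutive (decodeMap f S) := by
  rintro ⟨y, b, z, s⟩
  simp [decodeMap]

variable [DecidableEq X] [Fintype Y] [DecidableEq Y] [Fintype Z] [DecidableEq Z]

/-- The protocol in which Alice sends her whole input to Bob. -/
noncomputable def sendInput (f : X → Y → Z) : QProtocol X Y Z where
  dA := 1
  dB := 1
  k := Fintype.card X
  rounds := 1
  held t := if t = 0 then Finset.univ else ∅
  shared i := if i.2.2 = fun _ => false then 1 else 0
  shared_norm := by
    rw [Fintype.sum_prod_type]
    simp only [Fintype.sum_prod_type, Finset.univ_unique, Finset.sum_singleton]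
    rw [Finset.sum_eq_single (fun _ => false)] <;> simp +contextual
  opA _ := ⟨_, involutive_matrix_mem_unitaryGroup (encodeMap_involutive _)⟩
  opB _ := ⟨_, involutive_matrix_mem_unitaryGroup (decodeMap_involutive f _)⟩

theorem state_sendInput (f : X → Y → Z) (x : X) (y : Y) :
    (sendInput f).state x y 1 (x, (0 : Fin 1), y, (0 : Fin 1), f x y, oneHot x) = 1 := by
  have h0 : decodeApply f y
      (extendBits fun j : ↥((sendInput f).held 0)ᶜ => oneHot x j.1) = 0 := by
    refine Eq.trans (congrArg _ (extendBits_of_forall_notMem _ fun j hj => ?_))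
      (decodeApply_false f y)
    exact Finset.mem_compl.1 hj (Finset.mem_univ j)
  have h1 : decodeApply f y
      (extendBits fun j : ↥((sendInput f).held 1)ᶜ => oneHot x j.1) = f x y := by
    refine Eq.trans (congrArg _ (extendBits_of_forall_mem _ fun j => ?_))
      (decodeApply_oneHot f x y)
    exact Finset.mem_compl.2 (Finset.notMem_empty j)
  simp only [state, roundStep]
  erw [bobApply_map, aliceApply_map, bobApply_map, aliceApply_map]
  simp only [encodeMap, decodeMap]
  erw [overwrite_self]
  refine (if_pos ⟨rfl, rfl, ?_⟩).trans (if_pos ?_)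
  · funext j
    refine (dif_pos (Finset.mem_univ j)).trans ?_
    have h := congrFun (overwrite_self ((sendInput f).held 0)ᶜ (oneHot x)) j
    exact (congrArg (fun u => xor u (oneHot x j)) h).trans (by simp)
  · exact (congrArg₂ (fun u v => u - (v - f x y)) h0 h1).trans (by simp)

theorem computes_sendInput (f : X → Y → Z) {ε : ℝ} (hε : 0 ≤ ε) :
    (sendInput f).Computes f ε := by
  intro x y
  refine (sub_le_self 1 hε).trans ?_
  have h := Finset.single_le_sum (s := Finset.univ)
    (f := fun c : GlobalBasis X Y Z (sendInput f).dA (sendInput f).dB (sendInput f).k =>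
      if c.2.2.2.2.1 = f x y then ‖(sendInput f).state x y (sendInput f).rounds c‖ ^ 2 else 0)
    (fun c _ => by split_ifs <;> positivity)
    (Finset.mem_univ (x, (0 : Fin 1), y, (0 : Fin 1), f x y, oneHot x))
  refine le_trans ?_ h
  have := state_sendInput f x y
  simp only [if_true]
  erw [this]
  simp

end SendInput

end QProtocol

/-- The infimum of the empty set is `0` in `ℕ`, so a lower bound on `QccErr` needs some protocol to
exist. -/
theorem exists_protocol_cost_eq_QccErr {X Y Z : Type*} [Fintype X] [DecidableEq X] [Fintype Y]
    [DecidableEq Y] [Fintype Z] [DecidableEq Z] [AddCommGroup Z] {ε : ℝ} (hε : 0 ≤ ε)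
    (f : X → Y → Z) :
    ∃ P : QProtocol X Y Z, P.Computes f ε ∧ P.cost = QccErr ε f :=
  Nat.sInf_mem (s := {n : ℕ | ∃ P : QProtocol X Y Z, P.Computes f ε ∧ P.cost = n})
    ⟨_, QProtocol.sendInput f, QProtocol.computes_sendInput f hε, rfl⟩

/-! ### The lower bound for the square problem. -/

section SquareProblem

variable {F : Type*} [Field F] [Fintype F] [DecidableEq F]

theorem PS_eq_one_iff (x y : F) : PS F x y = 1 ↔ IsSquare (x + y) := by
  rw [PS, isSquare_iff_exists_sq]
  split_ifs with h <;> simp [h]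

theorem PS_eq_zero_iff (x y : F) : PS F x y = 0 ↔ ¬IsSquare (x + y) := by
  rw [PS, isSquare_iff_exists_sq]
  split_ifs with h <;> simp [h]

variable {P : QProtocol F F (Fin 2)}

theorem le_outputProb_of_isSquare (hP : P.Computes (PS F) (1 / 3)) {x y : F}
    (h : IsSquare (x + y)) : 2 / 3 ≤ P.outputProb x y 1 := by
  have := hP x y
  rw [(PS_eq_one_iff x y).2 h] at this
  linarith

theorem outputProb_le_of_not_isSquare (hP : P.Computes (PS F) (1 / 3)) {x y : F}
    (h : ¬IsSquare (x + y)) : P.outputProb x y 1 ≤ 1 / 3 := by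
  have := hP x y
  rw [(PS_eq_zero_iff x y).2 h] at this
  have hs := P.sum_outputProb_le_one x y
  rw [Fin.sum_univ_two] at hs
  linarith

theorem one_le_cost_of_computes_PS (hF : ringChar F ≠ 2) (hP : P.Computes (PS F) (1 / 3)) :
    1 ≤ P.cost := by
  by_contra h
  obtain ⟨a, ha⟩ := FiniteField.exists_nonsquare hF
  have h1 := le_outputProb_of_isSquare hP (x := 0) (y := 0) (by simp)
  have h2 := outputProb_le_of_not_isSquare hP (x := a) (y := 0) (by simpa using ha)
  rw [P.outputProb_eq_of_cost_eq_zero (by omega) 0 a] at h1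
  linarith

theorem le_sum_quadraticChar_mul_outputProb (hF : ringChar F ≠ 2)
    (hP : P.Computes (PS F) (1 / 3)) :
    (Fintype.card F : ℝ) * ((Fintype.card F : ℝ) - 1) / 6
      ≤ ∑ x : F, ∑ y : F, (quadraticChar F (x + y) : ℝ) * P.outputProb x y 1 := by
  -- The acceptance probability is on the correct side of `1/2` by at least `1/6`; the `χ / 2` part
  -- then sums to zero over each row.
  have hterm : ∀ x y : F, (quadraticChar F (x + y) : ℝ) / 2 + (if x + y = 0 then 0 else 1 / 6)
      ≤ (quadraticChar F (x + y) : ℝ) * P.outputProb x y 1 := by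
    intro x y
    by_cases h0 : x + y = 0
    · simp [h0]
    · by_cases hs : IsSquare (x + y)
      · have := le_outputProb_of_isSquare hP hs
        rw [(quadraticChar_one_iff_isSquare h0).2 hs, if_neg h0]
        push_cast
        linarith
      · have := outputProb_le_of_not_isSquare hP hs
        rw [quadraticChar_neg_one_iff_not_isSquare.2 hs, if_neg h0]
        push_cast
        linarith
  have hrow : ∀ x : F, ((Fintype.card F : ℝ) - 1) / 6
      = ∑ y : F, ((quadraticChar F (x + y) : ℝ) / 2 + (if x + y = 0 then 0 else 1 / 6)) := by
    intro x
    have h1 : ∑ y : F, ((quadraticChar F (x + y) : ℝ) / 2 + (if x + y = 0 then 0 else 1 / 6))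
        = ∑ y : F, ((quadraticChar F y : ℝ) / 2 + (if y = 0 then 0 else 1 / 6)) :=
      Fintype.sum_equiv (Equiv.addLeft x) _ _ fun y => rfl
    have h2 : ∑ y : F, (quadraticChar F y : ℝ) = 0 := by
      exact_mod_cast quadraticChar_sum_zero hF
    rw [h1, Finset.sum_add_distrib, ← Finset.sum_div, h2]
    simp [Finset.sum_ite, Finset.filter_ne', Nat.cast_sub (Fintype.card_pos (α := F))]
    ring
  calc (Fintype.card F : ℝ) * (Fintype.card F - 1) / 6
      = ∑ _x : F, ((Fintype.card F : ℝ) - 1) / 6 := by simp; ring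
    _ ≤ _ := Finset.sum_le_sum fun x _ => (hrow x).le.trans (Finset.sum_le_sum fun y _ => hterm x y)

theorem logb_card_le_cost (hF : ringChar F ≠ 2) (hcard : 3 ≤ Fintype.card F)
    (hP : P.Computes (PS F) (1 / 3)) : Real.logb 2 (Fintype.card F) ≤ 12 * P.cost := by
  set q : ℝ := (Fintype.card F : ℝ) with hq
  have hq3 : 3 ≤ q := by rw [hq]; exact_mod_cast hcard
  have hq0 : 0 < q := by linarith
  have hs0 : 0 < √q := Real.sqrt_pos.2 hq0
  have hss : √q * √q = q := Real.mul_self_sqrt hq0.le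
  have h := (le_sum_quadraticChar_mul_outputProb hF hP).trans
    ((le_abs_self _).trans (P.abs_sum_quadraticChar_mul_outputProb_le hF 1))
  rw [← hq] at h
  set N : ℝ := ((2 : ℝ) ^ P.cost) ^ 2 with hN
  have h1 : (q - 1) / 6 ≤ N * √q := by
    refine le_of_mul_le_mul_right ?_ hq0
    linarith
  -- From `q ≥ 3`, `q ≤ (3/2) * (q - 1)`, which turns the factor 6 into 9.
  have h2 : √q ≤ 9 * N := by
    refine le_of_mul_le_mul_right ?_ hs0
    linarith
  have hN4 : 4 ≤ N := by
    have : (2 : ℝ) ^ 1 ≤ 2 ^ P.cost :=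
      pow_le_pow_right₀ one_le_two (one_le_cost_of_computes_PS hF hP)
    rw [hN]; nlinarith
  -- Since `N ≥ 4`, the constant 9 is at most `N ^ 2`; squaring gives `q ≤ N ^ 6 = 2 ^ (12 *
  -- P.cost)`, the source of `c = 1/12`.
  have h3 : √q ≤ N ^ 3 := by nlinarith [mul_nonneg (sub_nonneg.2 hN4) (sub_nonneg.2 hN4)]
  have h4 : q ≤ (2 : ℝ) ^ (12 * P.cost) := by
    calc q = √q ^ 2 := by rw [sq, hss]
      _ ≤ (N ^ 3) ^ 2 := pow_le_pow_left₀ hs0.le h3 2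
      _ = _ := by rw [hN, ← pow_mul, ← pow_mul, ← pow_mul]; congr 1; ring
  calc Real.logb 2 q ≤ Real.logb 2 ((2 : ℝ) ^ (12 * P.cost)) :=
        Real.logb_le_logb_of_le one_lt_two hq0 h4
    _ = 12 * P.cost := by
        rw [← Real.rpow_natCast, Real.logb_rpow two_pos (by norm_num)]; push_cast; ring

end SquareProblem

theorem mainTheorem4 :
    ∃ c : ℝ, 0 < c ∧
      ∀ (p n : ℕ), p.Prime → Odd p → 0 < n →
        ∀ (F : Type*) [Field F] [Fintype F] [DecidableEq F], Fintype.card F = p ^ n →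
          c * Real.logb 2 (Fintype.card F) ≤ (Qcc (PS F) : ℝ) := by
  refine ⟨1 / 12, by norm_num, fun p n hp hodd hn F _ _ _ hF => ?_⟩
  have hp3 : 3 ≤ p := by
    have := hp.two_le
    rcases hodd with ⟨r, rfl⟩
    omega
  have hcard : 3 ≤ Fintype.card F := by
    rw [hF]; exact hp3.trans (Nat.le_self_pow hn.ne' p)
  have hchar : ringChar F ≠ 2 := by
    intro h
    have hc := FiniteField.even_card_of_char_two h
    rw [hF] at hc
    have := Nat.odd_iff.1 (hodd.pow (n := n))
    omega
  obtain ⟨P, hP, hcost⟩ := exists_protocol_cost_eq_QccErr (ε := 1 / 3) (by norm_num) (PS F)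
  rw [Qcc, ← hcost]
  have := logb_card_le_cost hchar hcard hP
  linarith
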